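/- For $B>0$ let $A(x)=\frac B2(-x_2,x_1,0)$ on $\mathbb{R}^3$, and let $H^1_A(\mathbb{R}^3)$ be the space of $\phi\in L^2(\mathbb{R}^3;\mathbb{C})$ whose distributional magnetic derivatives $(-i\partial_j+A_j)\phi$, $j=1,2,3$, lie in $L^2$. For $\phi\in H^1_A(\mathbb{R}^3)$ define the Pekar functional (with coupling constant $\alpha=1$) $$\mathcal{E}_B[\phi]=\sum_{j=1}^{3}\|(-i\partial_j+A_j)\phi\|_{L^2}^2-\frac12\iint_{\mathbb{R}^3\times\mathbb{R}^3}\frac{|\phi(x)|^2|\phi(y)|^2}{|x-y|}\,dx\,dy ,$$ and let $E_B^{\mathrm c}=\inf\{\mathcal{E}_B[\phi]:\phi\in H^1_A(\mathbb{R}^3),\ \|\phi\|_{L^2}=1\}$. For $B>1$ let $$\varphi_B(x)=\sqrt{\frac{B}{2\pi}}\,\exp\Big(-\frac B4(x_1^2+x_2^2)\Big)\,\frac{\sqrt{|\ln B|}}{2\sqrt2}\,\Big(\cosh\frac{|\ln B|\,x_3}{4}\Big)^{-1}.$$ There is a constant $C>0$ such that for every $B>1$ the function $\varphi_B$ belongs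 to $H^1_A(\mathbb{R}^3)$, satisfies $\|\varphi_B\|_{L^2}=1$, and $$E_B^{\mathrm c}\le\mathcal{E}_B[\varphi_B]\le B-\frac1{48}(\ln B)^2+\frac1{12}(\ln B)(\ln\ln B)+C\ln B .$$ -/

import Mathlib

open MeasureTheory

noncomputable section

/-- Three-dimensional Euclidean space; the coordinates `x 0, x 1, x 2` are `x₁, x₂, x₃`. -/
abbrev E3 : Type := EuclideanSpace ℝ (Fin 3)

/-- The vector potential `A(x) = (B/2) (-x₂, x₁, 0)` of the homogeneous magnetic field of
strength `B` in the `x₃`-direction, in the symmetric gauge. -/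
def vecPot (B : ℝ) (x : E3) : Fin 3 → ℝ :=
  ![-(B / 2) * x 1, (B / 2) * x 0, 0]

/-- `g = (-i ∂ⱼ + Aⱼ) φ` in the sense of distributions: `g` is locally integrable and
`∫ η g = ∫ (i ∂ⱼη + Aⱼ η) φ` for all test functions `η ∈ C_c^∞(ℝ³)`. -/
def IsWeakMagDeriv (B : ℝ) (j : Fin 3) (φ g : E3 → ℂ) : Prop :=
  LocallyIntegrable g volume ∧
    ∀ η : E3 → ℝ, ContDiff ℝ (⊤ : ℕ∞) η → HasCompactSupport η →
      ∫ x, (η x : ℂ) * g x =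
        ∫ x, (Complex.I * (fderiv ℝ η x (EuclideanSpace.single j 1) : ℂ)
          + (vecPot B x j : ℂ) * (η x : ℂ)) * φ x

/-- The weak magnetic derivative is unique up to null sets. -/
theorem IsWeakMagDeriv.ae_eq {B : ℝ} {j : Fin 3} {φ g h : E3 → ℂ}
    (hg : IsWeakMagDeriv B j φ g) (hh : IsWeakMagDeriv B j φ h) : g =ᵐ[volume] h := by
  refine ae_eq_of_integral_contDiff_smul_eq hg.1 hh.1 fun η hη hc => ?_
  simpa only [Complex.real_smul] using (hg.2 η hη hc).trans (hh.2 η hη hc).symm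

open Classical in
/-- The weak magnetic derivative `(-i ∂ⱼ + Aⱼ) φ`, a function determined up to null sets
(only used for functions `φ` that have one). -/
def magDeriv (B : ℝ) (j : Fin 3) (φ : E3 → ℂ) : E3 → ℂ :=
  if h : ∃ g, IsWeakMagDeriv B j φ g then h.choose else 0

/-- `φ` belongs to the magnetic Sobolev space `H¹_A(ℝ³)`: `φ ∈ L²` and, for `j = 1, 2, 3`,
the distribution `(-i ∂ⱼ + Aⱼ) φ` is in `L²`. -/
def MemH1A (B : ℝ) (φ : E3 → ℂ) : Prop :=
  MemLp φ 2 volume ∧ ∀ j : Fin 3, ∃ g : E3 → ℂ, IsWeakMagDeriv B j φ g ∧ MemLp g 2 volume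

/-- The quadratic form `(φ, H_B φ) + (φ, -∂₃² φ)` on `H¹_A(ℝ³)`, that is, the sum of
`‖(-i ∂ⱼ + Aⱼ) φ‖²` over `j = 1, 2, 3` (recall that `A₃ = 0`). -/
def kineticEnergy (B : ℝ) (φ : E3 → ℂ) : ENNReal :=
  ∑ j : Fin 3, ∫⁻ x, ‖magDeriv B j φ x‖ₑ ^ 2

/-- The double integral `∬ |φ(x)|² |φ(y)|² / |x - y| dx dy`. -/
def coulombIntegral (φ : E3 → ℂ) : ENNReal :=
  ∫⁻ x : E3, ∫⁻ y : E3, ENNReal.ofReal (‖φ x‖ ^ 2 * ‖φ y‖ ^ 2 / ‖x - y‖)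

/-- The Pekar functional
`𝓔_B[φ] = (φ, H_B φ) + (φ, -∂₃² φ) - (α/2) ∬ |φ(x)|² |φ(y)|² / |x - y| dx dy`.
On `H¹_A(ℝ³)` the kinetic part is finite, so the difference is meaningful in `EReal`. -/
def pekarFunctional (α B : ℝ) (φ : E3 → ℂ) : EReal :=
  (kineticEnergy B φ : EReal) - ((ENNReal.ofReal (α / 2) * coulombIntegral φ : ENNReal) : EReal)

/-- The ground state energy `E_B^c = inf {𝓔_B[φ] : ‖φ‖ = 1, φ ∈ H¹_A(ℝ³)}`. -/
def pekarGroundEnergy (α B : ℝ) : EReal :=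
  sInf {e : EReal | ∃ φ : E3 → ℂ,
    MemH1A B φ ∧ eLpNorm φ 2 volume = 1 ∧ e = pekarFunctional α B φ}

/-- The trial function
`φ_B(x) = √(B/2π) exp(-B |x_⊥|² / 4) · (√|ln B| / (2√2)) / cosh (|ln B| x₃ / 4)`. -/
def trialState (B : ℝ) (x : E3) : ℂ :=
  ((Real.sqrt (B / (2 * Real.pi)) * Real.exp (-(B / 4) * (x 0 ^ 2 + x 1 ^ 2))
    * (Real.sqrt |Real.log B| / (2 * Real.sqrt 2))
    * (Real.cosh (|Real.log B| * x 2 / 4))⁻¹ : ℝ) : ℂ)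

end

/-! The density of `trialState` factorises into two Gaussians of variance `1 / B` across the field
and `(k / 2) sech² (k z)` along it, with `k = L / 4` and `L = log B`. The kinetic energy is then
exact: each transverse direction contributes `B / 2`, and the longitudinal one `k² / 3 = L² / 48`.

It remains to bound the Coulomb integral below. In the variable `v = y - x` it is the integral of
the density's autocorrelation over `|v|`. Transversally this autocorrelation is Gaussian with
variance `2 / B`; longitudinally it is at least `tent k`, by a Lipschitz estimate. Since `R ↦ (R +
w²)^(-1/2)` is convex, Jensen's inequality (in tangent-line form, `integral_coulombMinorant`)
replaces `v₁² + v₂²` by its mean `a² = 4 / B`. The remaining one-dimensional integral diverges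
logarithmically as `a → 0` and is at least `(L / 6) (L / 2 - log L + O(1))`
(`le_integral_tent_div_sqrt`). Half of it is subtracted, and `L² / 48 - L² / 24 = -L² / 48`. -/

noncomputable section

open Filter Topology

/-! ### One-dimensional Gaussian density: moments and autocorrelation. -/

/-- The density of the centred Gaussian of variance `1 / B`. -/
def gaussDensity (B s : ℝ) : ℝ := Real.sqrt (B / (2 * Real.pi)) * Real.exp (-(B / 2) * s ^ 2)

/-- The probability density `(k / 2) sech² (k z)`. -/
def sechDensity (k z : ℝ) : ℝ := k / 2 * (Real.cosh (k * z))⁻¹ ^ 2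

theorem gaussDensity_nonneg (B s : ℝ) : 0 ≤ gaussDensity B s := by
  unfold gaussDensity; positivity

theorem continuous_gaussDensity (B : ℝ) : Continuous (gaussDensity B) := by
  unfold gaussDensity; fun_prop

theorem integrable_gaussDensity {B : ℝ} (hB : 0 < B) : Integrable (gaussDensity B) :=
  (integrable_exp_neg_mul_sq (half_pos hB)).const_mul _

theorem integral_gaussDensity {B : ℝ} (hB : 0 < B) : ∫ s, gaussDensity B s = 1 := by
  unfold gaussDensity
  rw [integral_const_mul, integral_gaussian, ← Real.sqrt_mul (by positivity)]
  rw [Real.sqrt_eq_one]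
  have := Real.pi_pos
  field_simp

theorem integrable_sq_mul_gaussDensity {B : ℝ} (hB : 0 < B) :
    Integrable fun s => s ^ 2 * gaussDensity B s := by
  have h := (integrable_rpow_mul_exp_neg_mul_sq (half_pos hB) (s := 2) (by norm_num)).const_mul
    (Real.sqrt (B / (2 * Real.pi)))
  refine h.congr (Eventually.of_forall fun s => ?_)
  simp only [gaussDensity, Real.rpow_two]
  ring

theorem integrable_id_mul_gaussDensity {B : ℝ} (hB : 0 < B) :
    Integrable fun s => s * gaussDensity B s := by
  refine ((integrable_gaussDensity hB).add (integrable_sq_mul_gaussDensity hB)).mono'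
    (continuous_id.mul (continuous_gaussDensity B)).aestronglyMeasurable
    (Eventually.of_forall fun s => ?_)
  have := gaussDensity_nonneg B s
  simp only [Pi.add_apply, norm_mul, Real.norm_eq_abs, abs_of_nonneg this]
  nlinarith [sq_nonneg (|s| - 1), sq_abs s, abs_nonneg s]

theorem hasDerivAt_gaussDensity (B s : ℝ) :
    HasDerivAt (gaussDensity B) (-(B * (s * gaussDensity B s))) s := by
  have h : HasDerivAt (fun s : ℝ => -(B / 2) * s ^ 2) (-(B / 2) * (2 * s)) s := by
    simpa using (hasDerivAt_pow 2 s).const_mul (-(B / 2))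
  refine (h.exp.const_mul (Real.sqrt (B / (2 * Real.pi)))).congr_deriv ?_
  simp only [gaussDensity]
  ring

theorem integral_sq_mul_gaussDensity {B : ℝ} (hB : 0 < B) :
    ∫ s, s ^ 2 * gaussDensity B s = 1 / B := by
  have hd : ∀ s, HasDerivAt (fun s => s * gaussDensity B s)
      (gaussDensity B s - B * (s ^ 2 * gaussDensity B s)) s := fun s =>
    ((hasDerivAt_id s).mul (hasDerivAt_gaussDensity B s)).congr_deriv (by simp; ring)
  have h2 := (integrable_sq_mul_gaussDensity hB).const_mul B
  have h := integral_eq_zero_of_hasDerivAt_of_integrable hd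
    ((integrable_gaussDensity hB).sub h2) (integrable_id_mul_gaussDensity hB)
  rw [integral_sub (integrable_gaussDensity hB) h2, integral_gaussDensity hB,
    integral_const_mul] at h
  field_simp
  linarith

/-- Completing the square, `s² + (s + t)² = 2 (s + t / 2)² + t² / 2`, separates the shift from the
integration variable. -/
theorem gaussDensity_mul_add {B : ℝ} (hB : 0 < B) (s t : ℝ) :
    gaussDensity B s * gaussDensity B (s + t) =
      gaussDensity (B / 2) t * gaussDensity (2 * B) (s + t / 2) := by
  have hs : Real.sqrt (B / (2 * Real.pi)) * Real.sqrt (B / (2 * Real.pi)) =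
      Real.sqrt (B / 2 / (2 * Real.pi)) * Real.sqrt (2 * B / (2 * Real.pi)) := by
    rw [← Real.sqrt_mul (by positivity), ← Real.sqrt_mul (by positivity)]
    congr 1; field_simp
  have he : Real.exp (-(B / 2) * s ^ 2) * Real.exp (-(B / 2) * (s + t) ^ 2) =
      Real.exp (-(B / 2 / 2) * t ^ 2) * Real.exp (-(2 * B / 2) * (s + t / 2) ^ 2) := by
    rw [← Real.exp_add, ← Real.exp_add]
    congr 1; ring
  unfold gaussDensity
  linear_combination (Real.exp (-(B / 2) * s ^ 2) * Real.exp (-(B / 2) * (s + t) ^ 2)) * hs +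
    Real.sqrt (B / 2 / (2 * Real.pi)) * Real.sqrt (2 * B / (2 * Real.pi)) * he

theorem integrable_gaussDensity_mul_add {B : ℝ} (hB : 0 < B) (t : ℝ) :
    Integrable fun s => gaussDensity B s * gaussDensity B (s + t) := by
  simp only [gaussDensity_mul_add hB]
  exact ((integrable_gaussDensity (B := 2 * B) (by positivity)).comp_add_right (t / 2)).const_mul _

theorem integral_gaussDensity_mul_add {B : ℝ} (hB : 0 < B) (t : ℝ) :
    ∫ s, gaussDensity B s * gaussDensity B (s + t) = gaussDensity (B / 2) t := by
  simp only [gaussDensity_mul_add hB]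
  rw [integral_const_mul, integral_add_right_eq_self (gaussDensity (2 * B)),
    integral_gaussDensity (by positivity), mul_one]

/-! ### The `sech²` density: moments and autocorrelation. -/

theorem sechDensity_nonneg {k : ℝ} (hk : 0 < k) (z : ℝ) : 0 ≤ sechDensity k z := by
  unfold sechDensity; positivity

theorem continuous_sechDensity (k : ℝ) : Continuous (sechDensity k) := by
  unfold sechDensity
  have : ∀ z, Real.cosh (k * z) ≠ 0 := fun z => (Real.cosh_pos _).ne'
  fun_prop (disch := assumption)

theorem inv_cosh_sq (u : ℝ) : (Real.cosh u)⁻¹ ^ 2 = 1 - Real.tanh u ^ 2 := by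
  have h := Real.cosh_sq u
  have h0 := (Real.cosh_pos u).ne'
  rw [Real.tanh_eq_sinh_div_cosh]
  field_simp
  linarith

theorem tanh_sq_le_one (u : ℝ) : Real.tanh u ^ 2 ≤ 1 := by
  have := inv_cosh_sq u
  have : 0 ≤ (Real.cosh u)⁻¹ ^ 2 := by positivity
  linarith

theorem hasDerivAt_tanh_const_mul (k z : ℝ) :
    HasDerivAt (fun z => Real.tanh (k * z)) (k * (Real.cosh (k * z))⁻¹ ^ 2) z := by
  have h1 : HasDerivAt (fun z => k * z) k z := by simpa using (hasDerivAt_id z).const_mul k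
  have h := h1.sinh.div h1.cosh (Real.cosh_pos _).ne'
  have e : (fun z => Real.tanh (k * z)) = (fun z => Real.sinh (k * z)) / fun z => Real.cosh (k * z) := by
    funext z; simp [Real.tanh_eq_sinh_div_cosh]
  rw [e]
  refine h.congr_deriv ?_
  have h2 := Real.cosh_sq (k * z)
  have h0 := (Real.cosh_pos (k * z)).ne'
  field_simp
  linear_combination k * h2

theorem tendsto_tanh_atTop : Tendsto Real.tanh atTop (𝓝 1) := by
  have h0 : Tendsto (fun x : ℝ => Real.exp (-(2 * x))) atTop (𝓝 0) :=
    Real.tendsto_exp_neg_atTop_nhds_zero.comp (tendsto_id.const_mul_atTop two_pos)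
  have h := (h0.const_sub 1).div (h0.const_add 1) (by norm_num)
  simp only [sub_zero, add_zero, div_one] at h
  refine h.congr fun x => ?_
  have e : Real.exp (-(2 * x)) = Real.exp (-x) * Real.exp (-x) := by
    rw [← Real.exp_add]; ring_nf
  have e1 : Real.exp x * Real.exp (-x) = 1 := by rw [← Real.exp_add]; simp
  have := Real.exp_pos x
  have := Real.exp_pos (-x)
  simp only [Pi.div_apply]
  rw [Real.tanh_eq, e, div_eq_div_iff (by positivity) (by positivity)]
  linear_combination (-2 * Real.exp (-x)) * e1

theorem tendsto_tanh_atBot : Tendsto Real.tanh atBot (𝓝 (-1)) := by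
  have h := (tendsto_tanh_atTop.comp tendsto_neg_atBot_atTop).neg
  refine h.congr fun x => ?_
  simp [Real.tanh_neg]

theorem integrable_sechDensity {k : ℝ} (hk : 0 < k) : Integrable (sechDensity k) := by
  have h := ((integrable_inv_one_add_sq).comp_mul_left' hk.ne').const_mul (k / 2)
  refine h.mono' (continuous_sechDensity k).aestronglyMeasurable (Eventually.of_forall fun z => ?_)
  rw [Real.norm_of_nonneg (sechDensity_nonneg hk z), sechDensity, inv_pow]
  gcongr
  have h2 := Real.cosh_sq (k * z)
  -- `|u| ≤ |sinh u|` gives `cosh² u ≥ 1 + u²`, hence domination by an integrable Cauchy profile.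
  have h3 : |k * z| ≤ |Real.sinh (k * z)| := by
    rcases le_total 0 (k * z) with h | h
    · rw [abs_of_nonneg h, abs_of_nonneg (Real.sinh_nonneg_iff.2 h)]
      exact Real.self_le_sinh_iff.2 h
    · rw [abs_of_nonpos h, abs_of_nonpos (Real.sinh_nonpos_iff.2 h)]
      exact neg_le_neg (Real.sinh_le_self_iff.2 h)
  have := sq_le_sq.2 h3
  linarith

theorem integrable_sechDensity_mul {k : ℝ} (hk : 0 < k) {f : ℝ → ℝ} (hf : Continuous f) {M : ℝ}
    (hM : ∀ z, |f z| ≤ M) : Integrable fun z => sechDensity k z * f z :=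
  (integrable_sechDensity hk).mul_bdd (c := M) hf.aestronglyMeasurable (Eventually.of_forall hM)

theorem continuous_tanh_const_mul (k : ℝ) : Continuous fun z => Real.tanh (k * z) :=
  continuous_iff_continuousAt.2 fun z => (hasDerivAt_tanh_const_mul k z).continuousAt

theorem integrable_sechDensity_mul_tanh_sq {k : ℝ} (hk : 0 < k) :
    Integrable fun z => sechDensity k z * Real.tanh (k * z) ^ 2 :=
  integrable_sechDensity_mul hk ((continuous_tanh_const_mul k).pow 2) (M := 1) fun z => by
    rw [abs_of_nonneg (sq_nonneg _)]; exact tanh_sq_le_one _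

theorem integral_sechDensity {k : ℝ} (hk : 0 < k) : ∫ z, sechDensity k z = 1 := by
  have hd : ∀ z, HasDerivAt (fun z => 1 / 2 * Real.tanh (k * z)) (sechDensity k z) z := fun z =>
    ((hasDerivAt_tanh_const_mul k z).const_mul (1 / 2)).congr_deriv (by simp only [sechDensity]; ring)
  rw [integral_of_hasDerivAt_of_tendsto hd (integrable_sechDensity hk)
    ((tendsto_tanh_atBot.comp (tendsto_id.const_mul_atBot hk)).const_mul _)
    ((tendsto_tanh_atTop.comp (tendsto_id.const_mul_atTop hk)).const_mul _)]
  norm_num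

/-- The integrand is the derivative of `tanh³ / 6`. This value yields both the longitudinal kinetic
energy and the autocorrelation at zero shift. -/
theorem integral_sechDensity_mul_tanh_sq {k : ℝ} (hk : 0 < k) :
    ∫ z, sechDensity k z * Real.tanh (k * z) ^ 2 = 1 / 3 := by
  have hd : ∀ z, HasDerivAt (fun z => 1 / 6 * Real.tanh (k * z) ^ 3)
      (sechDensity k z * Real.tanh (k * z) ^ 2) z := fun z =>
    (((hasDerivAt_tanh_const_mul k z).pow 3).const_mul (1 / 6)).congr_deriv
      (by simp only [sechDensity]; push_cast; ring)
  rw [integral_of_hasDerivAt_of_tendsto hd (integrable_sechDensity_mul_tanh_sq hk)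
    (((tendsto_tanh_atBot.comp (tendsto_id.const_mul_atBot hk)).pow 3).const_mul _)
    (((tendsto_tanh_atTop.comp (tendsto_id.const_mul_atTop hk)).pow 3).const_mul _)]
  norm_num

theorem sechDensity_le {k : ℝ} (hk : 0 < k) (z : ℝ) : sechDensity k z ≤ k / 2 := by
  rw [sechDensity, inv_cosh_sq]
  nlinarith [sq_nonneg (Real.tanh (k * z))]

theorem sechDensity_sq (k z : ℝ) : sechDensity k z * sechDensity k z =
    k / 2 * (sechDensity k z - sechDensity k z * Real.tanh (k * z) ^ 2) := by
  simp only [sechDensity, inv_cosh_sq]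
  ring

theorem integral_sechDensity_sq {k : ℝ} (hk : 0 < k) :
    ∫ z, sechDensity k z * sechDensity k z = k / 3 := by
  simp only [sechDensity_sq]
  rw [integral_const_mul,
    integral_sub (integrable_sechDensity hk) (integrable_sechDensity_mul_tanh_sq hk),
    integral_sechDensity hk, integral_sechDensity_mul_tanh_sq hk]
  ring

theorem abs_sechDensity_sub_le (k x y : ℝ) :
    |sechDensity k x - sechDensity k y| ≤ k ^ 2 * |x - y| := by
  have hd : ∀ z, HasDerivAt (sechDensity k)
      (-(k ^ 2 * ((Real.cosh (k * z))⁻¹ ^ 2 * Real.tanh (k * z)))) z := fun z => by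
    have e : sechDensity k = fun z => k / 2 * (1 - Real.tanh (k * z) ^ 2) := by
      funext z; rw [sechDensity, inv_cosh_sq]
    rw [e]
    exact ((((hasDerivAt_tanh_const_mul k z).pow 2).const_sub 1).const_mul (k / 2)).congr_deriv
      (by push_cast; ring)
  refine Convex.norm_image_sub_le_of_norm_hasDerivWithin_le (s := Set.univ)
    (fun z _ => (hd z).hasDerivWithinAt) (fun z _ => ?_) convex_univ trivial trivial
  have h1 : (Real.cosh (k * z))⁻¹ ^ 2 ≤ 1 := by
    rw [inv_cosh_sq]; linarith [sq_nonneg (Real.tanh (k * z))]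
  have h2 : |Real.tanh (k * z)| ≤ 1 := (sq_le_one_iff_abs_le_one _).1 (tanh_sq_le_one _)
  rw [norm_neg, norm_mul, norm_mul, Real.norm_eq_abs, Real.norm_eq_abs, Real.norm_eq_abs,
    abs_of_nonneg (sq_nonneg k), abs_of_nonneg (sq_nonneg (Real.cosh (k * z))⁻¹)]
  have := mul_le_one₀ h1 (abs_nonneg _) h2
  nlinarith [sq_nonneg k]

theorem integrable_sechDensity_mul_add {k : ℝ} (hk : 0 < k) (w : ℝ) :
    Integrable fun z => sechDensity k z * sechDensity k (z + w) :=
  integrable_sechDensity_mul hk ((continuous_sechDensity k).comp (continuous_add_const w))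
    fun z => by
      rw [abs_of_nonneg (sechDensity_nonneg hk _)]; exact sechDensity_le hk _

/-- At zero shift the value is `k / 3`. The density is `k²`-Lipschitz and has mass one, so shifting
by `w` costs at most `k² |w|`. -/
theorem le_integral_sechDensity_mul_add {k : ℝ} (hk : 0 < k) (w : ℝ) :
    k / 3 - k ^ 2 * |w| ≤ ∫ z, sechDensity k z * sechDensity k (z + w) := by
  have h0 := integrable_sechDensity_mul_add hk 0
  simp only [add_zero] at h0
  have h1 := (integrable_sechDensity hk).mul_const (k ^ 2 * |w|)
  calc k / 3 - k ^ 2 * |w|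
      = ∫ z, (sechDensity k z * sechDensity k z - sechDensity k z * (k ^ 2 * |w|)) := by
        rw [integral_sub h0 h1, integral_sechDensity_sq hk, integral_mul_const,
          integral_sechDensity hk, one_mul]
    _ ≤ _ := by
        refine integral_mono (h0.sub h1) (integrable_sechDensity_mul_add hk w) fun z => ?_
        have h := abs_sechDensity_sub_le k z (z + w)
        rw [sub_add_cancel_left, abs_neg] at h
        have := (abs_le.1 h).2
        have := sechDensity_nonneg hk z
        simp only
        nlinarith

/-! ### The tent minorant and the logarithm. -/

/-- The lower bound `max 0 (k / 3 - k² |w|)` for the autocorrelation of `sechDensity k`. -/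
def tent (k w : ℝ) : ℝ := max 0 (k / 3 - k ^ 2 * |w|)

theorem tent_nonneg (k w : ℝ) : 0 ≤ tent k w := le_max_left _ _

theorem continuous_tent (k : ℝ) : Continuous (tent k) := by
  unfold tent; fun_prop

theorem hasCompactSupport_tent {k : ℝ} (hk : 0 < k) : HasCompactSupport (tent k) := by
  refine HasCompactSupport.intro (K := Metric.closedBall 0 (1 / (3 * k)))
    (isCompact_closedBall 0 _) fun w hw => ?_
  simp only [Metric.mem_closedBall, dist_zero_right, Real.norm_eq_abs, not_le] at hw
  refine max_eq_left ?_
  rw [div_lt_iff₀ (by positivity)] at hw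
  nlinarith

theorem tent_le {k : ℝ} (hk : 0 < k) (w : ℝ) :
    tent k w ≤ ∫ z, sechDensity k z * sechDensity k (z + w) :=
  max_le (integral_nonneg fun _ => mul_nonneg (sechDensity_nonneg hk _) (sechDensity_nonneg hk _))
    (le_integral_sechDensity_mul_add hk w)

theorem integrable_tent_mul {k : ℝ} (hk : 0 < k) {f : ℝ → ℝ} (hf : Continuous f) :
    Integrable fun w => tent k w * f w :=
  ((continuous_tent k).mul hf).integrable_of_hasCompactSupport (hasCompactSupport_tent hk).mul_right

/-- A logarithmic lower bound for the one-dimensional Coulomb energy regularised at length `a`. -/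
theorem le_integral_tent_div_sqrt {k a : ℝ} (hk : 0 < k) (ha : 0 < a) :
    2 * k / 3 * (Real.log (1 / (3 * k * a)) - 1) ≤
      ∫ w, tent k w * (Real.sqrt (a ^ 2 + w ^ 2))⁻¹ := by
  have hpos : ∀ w : ℝ, 0 < a ^ 2 + w ^ 2 := fun w => by positivity
  have hcont : Continuous fun w : ℝ => (Real.sqrt (a ^ 2 + w ^ 2))⁻¹ := by
    have : ∀ w : ℝ, Real.sqrt (a ^ 2 + w ^ 2) ≠ 0 := fun w => (Real.sqrt_pos.2 (hpos w)).ne'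
    fun_prop (disch := assumption)
  have hint := integrable_tent_mul hk hcont
  -- The integrand is even, so the whole line gives twice the half-line.
  have heven := integral_comp_abs (f := fun w => tent k w * (Real.sqrt (a ^ 2 + w ^ 2))⁻¹)
  have e : ∀ w, tent k |w| * (Real.sqrt (a ^ 2 + |w| ^ 2))⁻¹ =
      tent k w * (Real.sqrt (a ^ 2 + w ^ 2))⁻¹ := fun w => by simp [tent]
  simp only [e] at heven
  rw [heven]
  -- The edge of the support of the tent, where `k² c = k / 3`.
  set c : ℝ := 1 / (3 * k) with hc
  have hc0 : 0 < c := by positivity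
  have hkc : k ^ 2 * c = k / 3 := by rw [hc]; field_simp
  have hset : ∫ w in (0 : ℝ)..c, tent k w * (Real.sqrt (a ^ 2 + w ^ 2))⁻¹ ≤
      ∫ w in Set.Ioi (0 : ℝ), tent k w * (Real.sqrt (a ^ 2 + w ^ 2))⁻¹ := by
    rw [intervalIntegral.integral_of_le hc0.le]
    exact setIntegral_mono_set hint.integrableOn
      (Eventually.of_forall fun w => mul_nonneg (tent_nonneg k w) (by positivity))
      (LE.le.eventuallyLE fun w hw => hw.1)
  -- An integrable-in-closed-form minorant on `[0, c]`: use `√(a² + w²) ≤ w + a` and `w / (w + a) ≤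
  -- 1`. The subtracted `k²` costs only `k² c = k / 3`.
  have hlog : ∫ w in (0 : ℝ)..c, (k / 3 * (w + a)⁻¹ - k ^ 2) =
      k / 3 * Real.log ((c + a) / a) - k / 3 := by
    have hi : IntervalIntegrable (fun w : ℝ => (w + a)⁻¹) volume 0 c := by
      refine ContinuousOn.intervalIntegrable (ContinuousOn.inv₀ (by fun_prop) fun w hw => ?_)
      rw [Set.uIcc_of_le hc0.le] at hw
      have := hw.1
      positivity
    rw [intervalIntegral.integral_sub (hi.const_mul _) (by simp),
      intervalIntegral.integral_const_mul,
      intervalIntegral.integral_comp_add_right (fun w : ℝ => w⁻¹), zero_add,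
      integral_inv_of_pos ha (by positivity), intervalIntegral.integral_const, sub_zero,
      smul_eq_mul]
    linarith
  have hmono : ∫ w in (0 : ℝ)..c, (k / 3 * (w + a)⁻¹ - k ^ 2) ≤
      ∫ w in (0 : ℝ)..c, tent k w * (Real.sqrt (a ^ 2 + w ^ 2))⁻¹ := by
    refine intervalIntegral.integral_mono_on hc0.le ?_ hint.intervalIntegrable fun w hw => ?_
    · refine ContinuousOn.intervalIntegrable (ContinuousOn.sub (ContinuousOn.mul continuousOn_const
        (ContinuousOn.inv₀ (by fun_prop) fun w hw => ?_)) continuousOn_const)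
      rw [Set.uIcc_of_le hc0.le] at hw
      have := hw.1
      positivity
    · have hw0 := hw.1
      have h1 : Real.sqrt (a ^ 2 + w ^ 2) ≤ w + a :=
        Real.sqrt_le_iff.2 ⟨by positivity, by nlinarith⟩
      have h2 : (w + a)⁻¹ ≤ (Real.sqrt (a ^ 2 + w ^ 2))⁻¹ :=
        inv_anti₀ (Real.sqrt_pos.2 (hpos w)) h1
      have h3 : k / 3 - k ^ 2 * w ≤ tent k w := by
        have := le_max_right 0 (k / 3 - k ^ 2 * |w|)
        rw [abs_of_nonneg hw0] at this
        simpa only [tent, abs_of_nonneg hw0] using this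
      have h4 : 0 < w + a := by positivity
      have h5 : w * (w + a)⁻¹ ≤ 1 := by
        rw [← div_eq_mul_inv, div_le_one h4]; linarith
      calc k / 3 * (w + a)⁻¹ - k ^ 2 ≤ (k / 3 - k ^ 2 * w) * (w + a)⁻¹ := by
            nlinarith [sq_nonneg k]
        _ ≤ tent k w * (w + a)⁻¹ := by gcongr
        _ ≤ _ := mul_le_mul_of_nonneg_left h2 (tent_nonneg k w)
  have hfin : Real.log (1 / (3 * k * a)) ≤ Real.log ((c + a) / a) := by
    refine Real.log_le_log (by positivity) ?_
    rw [hc, le_div_iff₀ ha]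
    have : 1 / (3 * k * a) * a = 1 / (3 * k) := by field_simp
    linarith
  have : k / 3 * Real.log (1 / (3 * k * a)) ≤ k / 3 * Real.log ((c + a) / a) := by gcongr
  linarith

/-! ### Integrals of product functions on `E3`. -/

theorem integrable_mul_mul_coord {f g h : ℝ → ℝ} (hf : Integrable f) (hg : Integrable g)
    (hh : Integrable h) : Integrable fun x : E3 => f (x 0) * g (x 1) * h (x 2) := by
  have hi : Integrable (fun x : Fin 3 → ℝ => ∏ i, (![f, g, h] i) (x i)) :=
    Integrable.fintype_prod (f := ![f, g, h]) fun i => by fin_cases i <;> assumption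
  have := (PiLp.volume_preserving_ofLp (Fin 3)).integrable_comp_of_integrable hi
  refine this.congr (Eventually.of_forall fun x => ?_)
  simp [Fin.prod_univ_three]

theorem integral_mul_mul_coord (f g h : ℝ → ℝ) :
    ∫ x : E3, f (x 0) * g (x 1) * h (x 2) = (∫ t, f t) * (∫ t, g t) * ∫ t, h t := by
  have hi := integral_fintype_prod_volume_eq_prod (E := fun _ : Fin 3 => ℝ) ![f, g, h]
  rw [← (EuclideanSpace.volume_preserving_symm_measurableEquiv_toLp (Fin 3)).integral_comp'] at hi
  simpa [Fin.prod_univ_three] using hi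

theorem lintegral_enorm_sq_eq {f : E3 → ℂ} {u : E3 → ℝ} (hu : Integrable u)
    (h : ∀ x, ‖f x‖ ^ 2 = u x) : ∫⁻ x, ‖f x‖ₑ ^ 2 = ENNReal.ofReal (∫ x, u x) := by
  rw [ofReal_integral_eq_lintegral_ofReal hu
    (Eventually.of_forall fun x => by simp only [Pi.zero_apply, ← h]; positivity)]
  refine lintegral_congr fun x => ?_
  rw [← h, ENNReal.ofReal_pow (norm_nonneg _), ofReal_norm]

/-! ### The trial amplitude: its square and its partial derivatives. -/

/-- The positive real amplitude of `trialState`. -/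
def trialAmplitude (B : ℝ) (x : E3) : ℝ :=
  Real.sqrt (B / (2 * Real.pi)) * Real.exp (-(B / 4) * (x 0 ^ 2 + x 1 ^ 2))
    * (Real.sqrt |Real.log B| / (2 * Real.sqrt 2))
    * (Real.cosh (|Real.log B| * x 2 / 4))⁻¹

theorem trialState_eq (B : ℝ) : trialState B = fun x => (trialAmplitude B x : ℂ) := rfl

theorem contDiff_trialAmplitude (B : ℝ) : ContDiff ℝ 1 (trialAmplitude B) := by
  have hcosh : ContDiff ℝ 1 fun x : E3 => (Real.cosh (|Real.log B| * x 2 / 4))⁻¹ :=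
    ContDiff.inv (Real.contDiff_cosh.comp (by fun_prop)) fun x => (Real.cosh_pos _).ne'
  have hexp : ContDiff ℝ 1 fun x : E3 => Real.exp (-(B / 4) * (x 0 ^ 2 + x 1 ^ 2)) := by fun_prop
  exact ((contDiff_const.mul hexp).mul contDiff_const).mul hcosh

theorem trialAmplitude_sq {B : ℝ} (hB : 1 < B) (x : E3) : trialAmplitude B x ^ 2 =
    gaussDensity B (x 0) * gaussDensity B (x 1) * sechDensity (Real.log B / 4) (x 2) := by
  have hL := Real.log_pos hB
  have h1 : Real.sqrt (B / (2 * Real.pi)) ^ 2 = B / (2 * Real.pi) :=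
    Real.sq_sqrt (by positivity)
  have h2 : Real.sqrt (Real.log B) ^ 2 = Real.log B := Real.sq_sqrt hL.le
  have h3 : Real.sqrt 2 ^ 2 = 2 := Real.sq_sqrt zero_le_two
  have h4 : Real.exp (-(B / 4) * (x 0 ^ 2 + x 1 ^ 2)) ^ 2 =
      Real.exp (-(B / 2) * x 0 ^ 2) * Real.exp (-(B / 2) * x 1 ^ 2) := by
    rw [← Real.exp_add, sq, ← Real.exp_add]; congr 1; ring
  have h5 : Real.log B * x 2 / 4 = Real.log B / 4 * x 2 := by ring
  have h6 : (Real.sqrt (Real.log B) / (2 * Real.sqrt 2)) ^ 2 = Real.log B / 8 := by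
    rw [div_pow, mul_pow, h2, h3]; norm_num
  rw [trialAmplitude, abs_of_pos hL, mul_pow, mul_pow, mul_pow, h4, h5, h6]
  simp only [gaussDensity, sechDensity]
  ring

theorem fderiv_apply_single_of_hasDerivAt {f : E3 → ℝ} {x : E3} {j : Fin 3} {d : ℝ}
    (hf : DifferentiableAt ℝ f x)
    (h : HasDerivAt (fun t : ℝ => f (x + t • EuclideanSpace.single j 1)) d 0) :
    fderiv ℝ f x (EuclideanSpace.single j 1) = d := by
  rw [← hf.lineDeriv_eq_fderiv]
  exact HasLineDerivAt.lineDeriv h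

theorem differentiableAt_trialAmplitude (B : ℝ) (x : E3) :
    DifferentiableAt ℝ (trialAmplitude B) x :=
  (contDiff_trialAmplitude B).differentiable one_ne_zero x

theorem hasDerivAt_exp_transverse (B y z : ℝ) :
    HasDerivAt (fun t : ℝ => Real.exp (-(B / 4) * ((y + t) ^ 2 + z ^ 2)))
      (-(B / 2) * y * Real.exp (-(B / 4) * (y ^ 2 + z ^ 2))) 0 := by
  have h := ((((hasDerivAt_id (0 : ℝ)).const_add y).pow 2).add_const (z ^ 2)).const_mul (-(B / 4))
  refine h.exp.congr_deriv ?_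
  simp
  ring

theorem fderiv_trialAmplitude_zero (B : ℝ) (x : E3) :
    fderiv ℝ (trialAmplitude B) x (EuclideanSpace.single 0 1) =
      -(B / 2) * x 0 * trialAmplitude B x := by
  refine fderiv_apply_single_of_hasDerivAt (differentiableAt_trialAmplitude B x) ?_
  have h := (((hasDerivAt_exp_transverse B (x 0) (x 1)).const_mul
    (Real.sqrt (B / (2 * Real.pi)))).mul_const (Real.sqrt |Real.log B| / (2 * Real.sqrt 2))).mul_const
    (Real.cosh (|Real.log B| * x 2 / 4))⁻¹
  refine (h.congr_of_eventuallyEq (Eventually.of_forall fun t => ?_)).congr_deriv ?_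
  · simp [trialAmplitude]
  · simp only [trialAmplitude]; ring

theorem fderiv_trialAmplitude_one (B : ℝ) (x : E3) :
    fderiv ℝ (trialAmplitude B) x (EuclideanSpace.single 1 1) =
      -(B / 2) * x 1 * trialAmplitude B x := by
  refine fderiv_apply_single_of_hasDerivAt (differentiableAt_trialAmplitude B x) ?_
  have h := (((hasDerivAt_exp_transverse B (x 1) (x 0)).const_mul
    (Real.sqrt (B / (2 * Real.pi)))).mul_const (Real.sqrt |Real.log B| / (2 * Real.sqrt 2))).mul_const
    (Real.cosh (|Real.log B| * x 2 / 4))⁻¹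
  refine (h.congr_of_eventuallyEq (Eventually.of_forall fun t => ?_)).congr_deriv ?_
  · simp [trialAmplitude, add_comm]
  · simp only [trialAmplitude, add_comm (x 0 ^ 2)]; ring

theorem fderiv_trialAmplitude_two {B : ℝ} (hB : 1 < B) (x : E3) :
    fderiv ℝ (trialAmplitude B) x (EuclideanSpace.single 2 1) =
      -(Real.log B / 4) * Real.tanh (Real.log B / 4 * x 2) * trialAmplitude B x := by
  refine fderiv_apply_single_of_hasDerivAt (differentiableAt_trialAmplitude B x) ?_
  have hL := Real.log_pos hB
  have h0 : HasDerivAt (fun t : ℝ => Real.log B * (x 2 + t) / 4) (Real.log B / 4) 0 := by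
    simpa using ((((hasDerivAt_id (0 : ℝ)).const_add (x 2)).const_mul (Real.log B)).div_const 4)
  have h := (h0.cosh.inv (Real.cosh_pos _).ne').const_mul (Real.sqrt (B / (2 * Real.pi)) *
    Real.exp (-(B / 4) * (x 0 ^ 2 + x 1 ^ 2)) * (Real.sqrt (Real.log B) / (2 * Real.sqrt 2)))
  refine (h.congr_of_eventuallyEq (Eventually.of_forall fun t => ?_)).congr_deriv ?_
  · simp [trialAmplitude, abs_of_pos hL]
  · have e : Real.log B / 4 * x 2 = Real.log B * x 2 / 4 := by ring
    have hc := (Real.cosh_pos (Real.log B * x 2 / 4)).ne'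
    simp only [trialAmplitude, abs_of_pos hL, Real.tanh_eq_sinh_div_cosh, e, add_zero]
    field_simp

/-! ### Weak and classical magnetic derivatives. -/

theorem continuous_vecPot (B : ℝ) (j : Fin 3) : Continuous fun x => vecPot B x j := by
  fin_cases j <;> simp [vecPot] <;> fun_prop

/-- The magnetic derivative of a real-valued `C¹` function. -/
def classicalMagDeriv (B : ℝ) (j : Fin 3) (ψ : E3 → ℝ) (x : E3) : ℂ :=
  -Complex.I * (fderiv ℝ ψ x (EuclideanSpace.single j 1) : ℂ) + (vecPot B x j : ℂ) * (ψ x : ℂ)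

theorem continuous_classicalMagDeriv (B : ℝ) (j : Fin 3) {ψ : E3 → ℝ} (hψ : ContDiff ℝ 1 ψ) :
    Continuous (classicalMagDeriv B j ψ) := by
  have h1 : Continuous fun x => fderiv ℝ ψ x (EuclideanSpace.single j 1) :=
    (hψ.continuous_fderiv one_ne_zero).clm_apply continuous_const
  have h2 := continuous_vecPot B j
  have h3 := hψ.continuous
  unfold classicalMagDeriv
  fun_prop

/-- Integration by parts against the compactly supported `η`; the potential term is the same on both
sides. -/
theorem isWeakMagDeriv_classicalMagDeriv (B : ℝ) (j : Fin 3) {ψ : E3 → ℝ} (hψ : ContDiff ℝ 1 ψ) :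
    IsWeakMagDeriv B j (fun x => (ψ x : ℂ)) (classicalMagDeriv B j ψ) := by
  refine ⟨(continuous_classicalMagDeriv B j hψ).locallyIntegrable, fun η hη hc => ?_⟩
  have hψ' : Continuous fun x => fderiv ℝ ψ x (EuclideanSpace.single j 1) :=
    (hψ.continuous_fderiv one_ne_zero).clm_apply continuous_const
  have hη' : Continuous fun x => fderiv ℝ η x (EuclideanSpace.single j 1) :=
    (hη.continuous_fderiv (by simp)).clm_apply continuous_const
  have hcη' : HasCompactSupport fun x => fderiv ℝ η x (EuclideanSpace.single j 1) :=
    hc.fderiv_apply ℝ _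
  have i1 : Integrable fun x => fderiv ℝ η x (EuclideanSpace.single j 1) * ψ x :=
    (hη'.mul hψ.continuous).integrable_of_hasCompactSupport hcη'.mul_right
  have i2 : Integrable fun x => η x * fderiv ℝ ψ x (EuclideanSpace.single j 1) :=
    (hη.continuous.mul hψ').integrable_of_hasCompactSupport hc.mul_right
  have i3 : Integrable fun x => η x * ψ x :=
    (hη.continuous.mul hψ.continuous).integrable_of_hasCompactSupport hc.mul_right
  have i4 : Integrable fun x => η x * (vecPot B x j * ψ x) :=
    (hη.continuous.mul ((continuous_vecPot B j).mul hψ.continuous)).integrable_of_hasCompactSupport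
      hc.mul_right
  have key := integral_mul_fderiv_eq_neg_fderiv_mul_of_integrable i1 i2 i3
    (fun x _ => hη.differentiable (by simp) x) (fun x _ => hψ.differentiable one_ne_zero x)
  have e1 : ∀ x, (η x : ℂ) * classicalMagDeriv B j ψ x =
      -Complex.I * ((η x * fderiv ℝ ψ x (EuclideanSpace.single j 1) : ℝ) : ℂ)
        + ((η x * (vecPot B x j * ψ x) : ℝ) : ℂ) := fun x => by
    simp only [classicalMagDeriv]; push_cast; ring
  have e2 : ∀ x, (Complex.I * (fderiv ℝ η x (EuclideanSpace.single j 1) : ℂ)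
          + (vecPot B x j : ℂ) * (η x : ℂ)) * (ψ x : ℂ) =
      Complex.I * ((fderiv ℝ η x (EuclideanSpace.single j 1) * ψ x : ℝ) : ℂ)
        + ((η x * (vecPot B x j * ψ x) : ℝ) : ℂ) := fun x => by
    push_cast; ring
  simp only [e1, e2]
  rw [integral_add (i2.ofReal.const_mul _) i4.ofReal, integral_add (i1.ofReal.const_mul _) i4.ofReal,
    integral_const_mul, integral_const_mul, integral_complex_ofReal, integral_complex_ofReal,
    integral_complex_ofReal, key]
  push_cast
  ring

/-- Uniqueness of the weak derivative makes the arbitrary choice in `magDeriv` harmless. -/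
theorem magDeriv_ae_eq {B : ℝ} {j : Fin 3} {φ g : E3 → ℂ} (h : IsWeakMagDeriv B j φ g) :
    magDeriv B j φ =ᵐ[volume] g := by
  have hex : ∃ g, IsWeakMagDeriv B j φ g := ⟨g, h⟩
  rw [magDeriv, dif_pos hex]
  exact hex.choose_spec.ae_eq h

theorem norm_sq_neg_I_mul_add (a b : ℝ) : ‖-Complex.I * (a : ℂ) + (b : ℂ)‖ ^ 2 = a ^ 2 + b ^ 2 := by
  rw [Complex.sq_norm, Complex.normSq_apply]
  simp
  ring

/-- For real `ψ` the derivative term is imaginary and the potential term real, so there is no cross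
term. -/
theorem norm_sq_classicalMagDeriv (B : ℝ) (j : Fin 3) (ψ : E3 → ℝ) (x : E3) :
    ‖classicalMagDeriv B j ψ x‖ ^ 2 =
      fderiv ℝ ψ x (EuclideanSpace.single j 1) ^ 2 + (vecPot B x j * ψ x) ^ 2 := by
  rw [← norm_sq_neg_I_mul_add, classicalMagDeriv]
  push_cast
  rfl

/-! ### Norm and kinetic energy of the trial state. -/

theorem norm_sq_trialState (B : ℝ) (x : E3) : ‖trialState B x‖ ^ 2 = trialAmplitude B x ^ 2 := by
  rw [trialState_eq, Complex.norm_real, Real.norm_eq_abs, sq_abs]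

theorem integrable_trialAmplitude_sq {B : ℝ} (hB : 1 < B) :
    Integrable fun x => trialAmplitude B x ^ 2 := by
  have hB0 : 0 < B := by linarith
  simp only [trialAmplitude_sq hB]
  exact integrable_mul_mul_coord (integrable_gaussDensity hB0) (integrable_gaussDensity hB0)
    (integrable_sechDensity (by have := Real.log_pos hB; positivity))

theorem integral_trialAmplitude_sq {B : ℝ} (hB : 1 < B) : ∫ x, trialAmplitude B x ^ 2 = 1 := by
  have hB0 : 0 < B := by linarith
  simp only [trialAmplitude_sq hB]
  rw [integral_mul_mul_coord, integral_gaussDensity hB0,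
    integral_sechDensity (by have := Real.log_pos hB; positivity)]
  norm_num

/-- Each transverse coordinate has second moment `1 / B`, giving `(B² / 4) (2 / B)`. This density
serves for both transverse derivatives, whose sum `B` is the lowest Landau level. -/
theorem integrable_transverse_sq {B : ℝ} (hB : 1 < B) :
    Integrable (fun x : E3 => B ^ 2 / 4 * (x 0 ^ 2 + x 1 ^ 2) * trialAmplitude B x ^ 2) ∧
    ∫ x : E3, B ^ 2 / 4 * (x 0 ^ 2 + x 1 ^ 2) * trialAmplitude B x ^ 2 = B / 2 := by
  have hB0 : 0 < B := by linarith
  have hk : 0 < Real.log B / 4 := by have := Real.log_pos hB; positivity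
  have hg := integrable_gaussDensity hB0
  have hg2 := integrable_sq_mul_gaussDensity hB0
  have hs := integrable_sechDensity hk
  have e : ∀ x : E3, B ^ 2 / 4 * (x 0 ^ 2 + x 1 ^ 2) * trialAmplitude B x ^ 2 =
      B ^ 2 / 4 * (x 0 ^ 2 * gaussDensity B (x 0) * gaussDensity B (x 1)
          * sechDensity (Real.log B / 4) (x 2)
        + gaussDensity B (x 0) * (x 1 ^ 2 * gaussDensity B (x 1))
          * sechDensity (Real.log B / 4) (x 2)) := fun x => by
    rw [trialAmplitude_sq hB]; ring
  have i1 := integrable_mul_mul_coord hg2 hg hs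
  have i2 := integrable_mul_mul_coord hg hg2 hs
  simp only [e]
  refine ⟨(i1.add i2).const_mul _, ?_⟩
  rw [integral_const_mul, integral_add i1 i2,
    integral_mul_mul_coord (fun t => t ^ 2 * gaussDensity B t) (gaussDensity B),
    integral_mul_mul_coord (gaussDensity B) (fun t => t ^ 2 * gaussDensity B t),
    integral_gaussDensity hB0, integral_sq_mul_gaussDensity hB0, integral_sechDensity hk]
  field_simp
  norm_num

theorem integrable_longitudinal_sq {B : ℝ} (hB : 1 < B) :
    Integrable (fun x : E3 => (Real.log B / 4) ^ 2 * (Real.tanh (Real.log B / 4 * x 2) ^ 2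
      * trialAmplitude B x ^ 2)) ∧
    ∫ x : E3, (Real.log B / 4) ^ 2 * (Real.tanh (Real.log B / 4 * x 2) ^ 2
      * trialAmplitude B x ^ 2) = Real.log B ^ 2 / 48 := by
  have hB0 : 0 < B := by linarith
  have hk : 0 < Real.log B / 4 := by have := Real.log_pos hB; positivity
  have hg := integrable_gaussDensity hB0
  have hs := integrable_sechDensity_mul_tanh_sq hk
  have e : ∀ x : E3, Real.tanh (Real.log B / 4 * x 2) ^ 2 * trialAmplitude B x ^ 2 =
      gaussDensity B (x 0) * gaussDensity B (x 1)
          * (sechDensity (Real.log B / 4) (x 2) * Real.tanh (Real.log B / 4 * x 2) ^ 2) := fun x => by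
    rw [trialAmplitude_sq hB]; ring
  simp only [e]
  refine ⟨(integrable_mul_mul_coord hg hg hs).const_mul _, ?_⟩
  rw [integral_const_mul, integral_mul_mul_coord (gaussDensity B) (gaussDensity B)
      (fun z => sechDensity (Real.log B / 4) z * Real.tanh (Real.log B / 4 * z) ^ 2),
    integral_gaussDensity hB0, integral_sechDensity_mul_tanh_sq hk]
  ring

/-- The squared modulus of the `j`-th magnetic derivative of the trial state. -/
def trialMagDensity (B : ℝ) (j : Fin 3) (x : E3) : ℝ :=
  ![B ^ 2 / 4 * (x 0 ^ 2 + x 1 ^ 2) * trialAmplitude B x ^ 2,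
    B ^ 2 / 4 * (x 0 ^ 2 + x 1 ^ 2) * trialAmplitude B x ^ 2,
    (Real.log B / 4) ^ 2 * (Real.tanh (Real.log B / 4 * x 2) ^ 2 * trialAmplitude B x ^ 2)] j

theorem norm_sq_classicalMagDeriv_trialAmplitude {B : ℝ} (hB : 1 < B) (j : Fin 3) (x : E3) :
    ‖classicalMagDeriv B j (trialAmplitude B) x‖ ^ 2 = trialMagDensity B j x := by
  rw [norm_sq_classicalMagDeriv]
  fin_cases j
  · simp [trialMagDensity, vecPot, fderiv_trialAmplitude_zero]; ring
  · simp [trialMagDensity, vecPot, fderiv_trialAmplitude_one]; ring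
  · simp [trialMagDensity, vecPot, fderiv_trialAmplitude_two hB]; ring

theorem integrable_trialMagDensity {B : ℝ} (hB : 1 < B) (j : Fin 3) :
    Integrable (trialMagDensity B j) := by
  fin_cases j
  · exact (integrable_transverse_sq hB).1
  · exact (integrable_transverse_sq hB).1
  · exact (integrable_longitudinal_sq hB).1

theorem isWeakMagDeriv_trialState (B : ℝ) (j : Fin 3) :
    IsWeakMagDeriv B j (trialState B) (classicalMagDeriv B j (trialAmplitude B)) :=
  isWeakMagDeriv_classicalMagDeriv B j (contDiff_trialAmplitude B)

theorem continuous_trialState (B : ℝ) : Continuous (trialState B) :=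
  Complex.continuous_ofReal.comp (contDiff_trialAmplitude B).continuous

theorem memH1A_trialState {B : ℝ} (hB : 1 < B) : MemH1A B (trialState B) := by
  refine ⟨?_, fun j => ⟨_, isWeakMagDeriv_trialState B j, ?_⟩⟩
  · rw [memLp_two_iff_integrable_sq_norm (continuous_trialState B).aestronglyMeasurable]
    simpa only [norm_sq_trialState] using integrable_trialAmplitude_sq hB
  · rw [memLp_two_iff_integrable_sq_norm
      (continuous_classicalMagDeriv B j (contDiff_trialAmplitude B)).aestronglyMeasurable]
    simpa only [norm_sq_classicalMagDeriv_trialAmplitude hB] using integrable_trialMagDensity hB j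

theorem eLpNorm_trialState {B : ℝ} (hB : 1 < B) : eLpNorm (trialState B) 2 volume = 1 := by
  rw [eLpNorm_eq_lintegral_rpow_enorm_toReal two_ne_zero ENNReal.ofNat_ne_top]
  have h := lintegral_enorm_sq_eq (integrable_trialAmplitude_sq hB) (norm_sq_trialState B)
  rw [integral_trialAmplitude_sq hB] at h
  simp [h]

theorem kineticEnergy_trialState {B : ℝ} (hB : 1 < B) :
    kineticEnergy B (trialState B) = ENNReal.ofReal (B + Real.log B ^ 2 / 48) := by
  have h : ∀ j, ∫⁻ x, ‖magDeriv B j (trialState B) x‖ₑ ^ 2 =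
      ENNReal.ofReal (∫ x, trialMagDensity B j x) := fun j => by
    rw [← lintegral_enorm_sq_eq (integrable_trialMagDensity hB j)
      (norm_sq_classicalMagDeriv_trialAmplitude hB j)]
    refine lintegral_congr_ae ?_
    filter_upwards [magDeriv_ae_eq (isWeakMagDeriv_trialState B j)] with x hx
    rw [hx]
  have h0 : ∫ x, trialMagDensity B 0 x = B / 2 := (integrable_transverse_sq hB).2
  have h1 : ∫ x, trialMagDensity B 1 x = B / 2 := (integrable_transverse_sq hB).2
  have h2 : ∫ x, trialMagDensity B 2 x = Real.log B ^ 2 / 48 := (integrable_longitudinal_sq hB).2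
  simp only [kineticEnergy, h, Fin.sum_univ_three, h0, h1, h2]
  rw [← ENNReal.ofReal_add (by linarith) (by linarith),
    ← ENNReal.ofReal_add (by linarith) (by positivity), add_halves]

/-! ### Lower bound on the Coulomb energy. -/

/-- The tangent line bound for `R ↦ R ^ (-1/2)`. -/
theorem tangent_le_inv {m n : ℝ} (hm : 0 < m) (hn : 0 < n) :
    (3 * m ^ 2 - n ^ 2) * (2 * m ^ 3)⁻¹ ≤ n⁻¹ := by
  rw [← div_eq_mul_inv, div_le_iff₀ (by positivity), inv_mul_eq_div, le_div_iff₀ hn]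
  -- The difference is `(m - n)² (2 m + n) = 2 m³ - 3 m² n + n³`.
  nlinarith [mul_nonneg (sq_nonneg (m - n)) (by positivity : 0 ≤ 2 * m + n)]

/-- No sign is assumed on `f`: the tangent minorant `coulombMinorant` becomes negative far from the
axis. -/
theorem ofReal_integral_le_lintegral {α : Type*} [MeasurableSpace α] {μ : Measure α} {f : α → ℝ}
    (hf : Integrable f μ) : ENNReal.ofReal (∫ x, f x ∂μ) ≤ ∫⁻ x, ENNReal.ofReal (f x) ∂μ := by
  rw [integral_eq_lintegral_pos_part_sub_lintegral_neg_part hf]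
  exact (ENNReal.ofReal_le_ofReal (sub_le_self _ ENNReal.toReal_nonneg)).trans
    ENNReal.ofReal_toReal_le

theorem norm_sq_E3 (v : E3) : ‖v‖ ^ 2 = v 0 ^ 2 + v 1 ^ 2 + v 2 ^ 2 := by
  rw [EuclideanSpace.norm_sq_eq, Fin.sum_univ_three]
  simp

/-- Substitute `y = x + v` and apply Tonelli. -/
theorem coulombIntegral_eq_lintegral_autocorrelation {φ : E3 → ℂ} (hφ : Continuous φ) :
    coulombIntegral φ =
      ∫⁻ v : E3, ∫⁻ x : E3, ENNReal.ofReal (‖φ x‖ ^ 2 * ‖φ (x + v)‖ ^ 2 / ‖v‖) := by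
  rw [← lintegral_lintegral_swap]
  · refine lintegral_congr fun x => ?_
    rw [← lintegral_add_left_eq_self _ x]
    simp
  · refine Measurable.aemeasurable ?_
    have h1 : Measurable fun p : E3 × E3 => ‖φ p.1‖ ^ 2 := by
      have : Continuous fun p : E3 × E3 => ‖φ p.1‖ ^ 2 := by fun_prop
      exact this.measurable
    have h2 : Measurable fun p : E3 × E3 => ‖φ (p.1 + p.2)‖ ^ 2 := by
      have : Continuous fun p : E3 × E3 => ‖φ (p.1 + p.2)‖ ^ 2 := by fun_prop
      exact this.measurable
    exact ((h1.mul h2).div measurable_snd.norm).ennreal_ofReal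

theorem trialAmplitude_sq_mul_add {B : ℝ} (hB : 1 < B) (v : E3) :
    Integrable (fun x => trialAmplitude B x ^ 2 * trialAmplitude B (x + v) ^ 2) ∧
    ∫ x, trialAmplitude B x ^ 2 * trialAmplitude B (x + v) ^ 2 =
      gaussDensity (B / 2) (v 0) * gaussDensity (B / 2) (v 1) *
        ∫ z, sechDensity (Real.log B / 4) z * sechDensity (Real.log B / 4) (z + v 2) := by
  have hB0 : 0 < B := by linarith
  have hk : 0 < Real.log B / 4 := by have := Real.log_pos hB; positivity
  have e : ∀ x : E3, trialAmplitude B x ^ 2 * trialAmplitude B (x + v) ^ 2 =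
      (gaussDensity B (x 0) * gaussDensity B (x 0 + v 0)) *
      (gaussDensity B (x 1) * gaussDensity B (x 1 + v 1)) *
      (sechDensity (Real.log B / 4) (x 2) * sechDensity (Real.log B / 4) (x 2 + v 2)) := fun x => by
    rw [trialAmplitude_sq hB, trialAmplitude_sq hB]
    simp only [PiLp.add_apply]
    ring
  simp only [e]
  refine ⟨integrable_mul_mul_coord (integrable_gaussDensity_mul_add hB0 _)
    (integrable_gaussDensity_mul_add hB0 _) (integrable_sechDensity_mul_add hk _), ?_⟩
  rw [integral_mul_mul_coord (fun s => gaussDensity B s * gaussDensity B (s + v 0))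
    (fun s => gaussDensity B s * gaussDensity B (s + v 1))
    (fun z => sechDensity (Real.log B / 4) z * sechDensity (Real.log B / 4) (z + v 2)),
    integral_gaussDensity_mul_add hB0, integral_gaussDensity_mul_add hB0]

/-- A pointwise minorant of the autocorrelation of the trial density divided by `|v|`, built from
the tangent to `R ↦ (R + v₃²)^(-1/2)` at `R = a²`. -/
def coulombMinorant (B k a : ℝ) (v : E3) : ℝ :=
  gaussDensity (B / 2) (v 0) * gaussDensity (B / 2) (v 1) * tent k (v 2) *
    ((3 * a ^ 2 + 2 * v 2 ^ 2 - v 0 ^ 2 - v 1 ^ 2) * (2 * Real.sqrt (a ^ 2 + v 2 ^ 2) ^ 3)⁻¹)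

theorem coulombMinorant_le (B k : ℝ) {a : ℝ} (ha : 0 < a) {v : E3} (hv : v ≠ 0) :
    coulombMinorant B k a v ≤
      gaussDensity (B / 2) (v 0) * gaussDensity (B / 2) (v 1) * tent k (v 2) * ‖v‖⁻¹ := by
  have hm : 0 < a ^ 2 + v 2 ^ 2 := by positivity
  refine mul_le_mul_of_nonneg_left ?_ (mul_nonneg (mul_nonneg (gaussDensity_nonneg _ _)
    (gaussDensity_nonneg _ _)) (tent_nonneg _ _))
  have h := tangent_le_inv (Real.sqrt_pos.2 hm) (norm_pos_iff.2 hv)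
  rw [Real.sq_sqrt hm.le, norm_sq_E3] at h
  rwa [show 3 * a ^ 2 + 2 * v 2 ^ 2 - v 0 ^ 2 - v 1 ^ 2 =
    3 * (a ^ 2 + v 2 ^ 2) - (v 0 ^ 2 + v 1 ^ 2 + v 2 ^ 2) by ring]

/-- `4 / B` is the mean of `v₁² + v₂²` when each has variance `2 / B`. The linear term of the
tangent at `a²` therefore averages to zero, leaving its value at the point of tangency. -/
theorem integral_coulombMinorant {B k a : ℝ} (hB : 0 < B) (hk : 0 < k) (ha : 0 < a)
    (haB : a ^ 2 = 4 / B) :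
    Integrable (coulombMinorant B k a) ∧
    ∫ v, coulombMinorant B k a v = ∫ w, tent k w * (Real.sqrt (a ^ 2 + w ^ 2))⁻¹ := by
  have hm : ∀ w : ℝ, 0 < a ^ 2 + w ^ 2 := fun w => by positivity
  have hc : Continuous fun w : ℝ => (2 * Real.sqrt (a ^ 2 + w ^ 2) ^ 3)⁻¹ := by
    have : ∀ w : ℝ, 2 * Real.sqrt (a ^ 2 + w ^ 2) ^ 3 ≠ 0 := fun w => by
      have := Real.sqrt_pos.2 (hm w)
      positivity
    fun_prop (disch := assumption)
  have hB2 : 0 < B / 2 := half_pos hB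
  have hg := integrable_gaussDensity hB2
  have hg2 := integrable_sq_mul_gaussDensity hB2
  have ht := integrable_tent_mul hk hc
  have ht' : Integrable fun w => tent k w *
      ((3 * a ^ 2 + 2 * w ^ 2) * (2 * Real.sqrt (a ^ 2 + w ^ 2) ^ 3)⁻¹) := integrable_tent_mul hk
    ((by fun_prop : Continuous fun w : ℝ => 3 * a ^ 2 + 2 * w ^ 2).mul hc)
  have e : coulombMinorant B k a = fun v =>
      gaussDensity (B / 2) (v 0) * gaussDensity (B / 2) (v 1) * (tent k (v 2) *
          ((3 * a ^ 2 + 2 * v 2 ^ 2) * (2 * Real.sqrt (a ^ 2 + v 2 ^ 2) ^ 3)⁻¹))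
      - (v 0 ^ 2 * gaussDensity (B / 2) (v 0)) * gaussDensity (B / 2) (v 1) *
          (tent k (v 2) * (2 * Real.sqrt (a ^ 2 + v 2 ^ 2) ^ 3)⁻¹)
      - gaussDensity (B / 2) (v 0) * (v 1 ^ 2 * gaussDensity (B / 2) (v 1)) *
          (tent k (v 2) * (2 * Real.sqrt (a ^ 2 + v 2 ^ 2) ^ 3)⁻¹) := by
    funext v; simp only [coulombMinorant]; ring
  have i1 := integrable_mul_mul_coord hg hg ht'
  have i2 := integrable_mul_mul_coord hg2 hg ht
  have i3 := integrable_mul_mul_coord hg hg2 ht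
  rw [e]
  refine ⟨(i1.sub i2).sub i3, ?_⟩
  refine (integral_sub (i1.sub i2) i3).trans ?_
  rw [integral_sub' i1 i2,
    integral_mul_mul_coord (gaussDensity (B / 2)) (gaussDensity (B / 2))
      (fun w => tent k w * ((3 * a ^ 2 + 2 * w ^ 2) * (2 * Real.sqrt (a ^ 2 + w ^ 2) ^ 3)⁻¹)),
    integral_mul_mul_coord (fun t => t ^ 2 * gaussDensity (B / 2) t) (gaussDensity (B / 2))
      (fun w => tent k w * (2 * Real.sqrt (a ^ 2 + w ^ 2) ^ 3)⁻¹),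
    integral_mul_mul_coord (gaussDensity (B / 2)) (fun t => t ^ 2 * gaussDensity (B / 2) t)
      (fun w => tent k w * (2 * Real.sqrt (a ^ 2 + w ^ 2) ^ 3)⁻¹),
    integral_gaussDensity hB2, integral_sq_mul_gaussDensity hB2]
  have e2 : ∀ w : ℝ, tent k w * (Real.sqrt (a ^ 2 + w ^ 2))⁻¹ =
      tent k w * ((3 * a ^ 2 + 2 * w ^ 2) * (2 * Real.sqrt (a ^ 2 + w ^ 2) ^ 3)⁻¹)
        - a ^ 2 * (tent k w * (2 * Real.sqrt (a ^ 2 + w ^ 2) ^ 3)⁻¹) := fun w => by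
    have h0 := Real.sqrt_pos.2 (hm w)
    have h1 : a ^ 2 = Real.sqrt (a ^ 2 + w ^ 2) ^ 2 - w ^ 2 := by
      rw [Real.sq_sqrt (hm w).le]; ring
    generalize Real.sqrt (a ^ 2 + w ^ 2) = m at h0 h1
    rw [h1]
    field_simp
    ring
  simp only [e2]
  rw [integral_sub ht' (ht.const_mul _), integral_const_mul, haB]
  field_simp
  ring

theorem le_coulombIntegral_trialState {B : ℝ} (hB : 1 < B) :
    ENNReal.ofReal (Real.log B / 6 *
      (Real.log B / 2 - Real.log (Real.log B) + Real.log (2 / 3) - 1)) ≤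
      coulombIntegral (trialState B) := by
  have hB0 : 0 < B := by linarith
  have hL := Real.log_pos hB
  have hk : 0 < Real.log B / 4 := by positivity
  set a : ℝ := 2 / Real.sqrt B with ha_def
  have ha : 0 < a := by positivity
  have haB : a ^ 2 = 4 / B := by rw [ha_def, div_pow, Real.sq_sqrt hB0.le]; norm_num
  obtain ⟨hint, heq⟩ := integral_coulombMinorant hB0 hk ha haB
  have hlog : Real.log (1 / (3 * (Real.log B / 4) * a)) =
      Real.log B / 2 - Real.log (Real.log B) + Real.log (2 / 3) := by
    have e : 1 / (3 * (Real.log B / 4) * a) = Real.sqrt B / Real.log B * (2 / 3) := by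
      rw [ha_def]; field_simp; norm_num
    rw [e, Real.log_mul (by positivity) (by norm_num), Real.log_div (by positivity) hL.ne',
      Real.log_sqrt hB0.le]
  have h1 := le_integral_tent_div_sqrt hk ha
  rw [hlog, ← heq] at h1
  calc _ ≤ ENNReal.ofReal (∫ v, coulombMinorant B (Real.log B / 4) a v) :=
        ENNReal.ofReal_le_ofReal (by linarith)
    _ ≤ ∫⁻ v, ENNReal.ofReal (coulombMinorant B (Real.log B / 4) a v) :=
        ofReal_integral_le_lintegral hint
    _ ≤ _ := by
        rw [coulombIntegral_eq_lintegral_autocorrelation (continuous_trialState B)]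
        refine lintegral_mono_ae ?_
        -- The origin must be excluded: division by zero returns `0` there.
        have hne : ∀ᵐ v : E3, v ≠ 0 := by simp [ae_iff]
        filter_upwards [hne] with v hv
        obtain ⟨hi, he⟩ := trialAmplitude_sq_mul_add hB v
        simp only [norm_sq_trialState]
        rw [← ofReal_integral_eq_lintegral_ofReal (hi.div_const _)
          (Eventually.of_forall fun x => by simp only [Pi.zero_apply]; positivity)]
        refine ENNReal.ofReal_le_ofReal ((coulombMinorant_le B _ ha hv).trans ?_)
        rw [integral_div, he, div_eq_mul_inv]
        have := gaussDensity_nonneg (B / 2)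
        exact mul_le_mul_of_nonneg_right (mul_le_mul_of_nonneg_left (tent_le hk _)
          (mul_nonneg (this _) (this _))) (inv_nonneg.2 (norm_nonneg v))

/-! ### Assembling the upper bound. -/

theorem pekarFunctional_trialState_le {B : ℝ} (hB : 1 < B) :
    pekarFunctional 1 B (trialState B) ≤
      ((B - 1 / 48 * Real.log B ^ 2 + 1 / 12 * Real.log B * Real.log (Real.log B)
        + 1 * Real.log B : ℝ) : EReal) := by
  have hL := Real.log_pos hB
  set D := Real.log B / 6 * (Real.log B / 2 - Real.log (Real.log B) + Real.log (2 / 3) - 1) with hD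
  have hc : ENNReal.ofReal (1 / 2 * D) ≤ ENNReal.ofReal (1 / 2) * coulombIntegral (trialState B) := by
    rw [ENNReal.ofReal_mul (by norm_num)]
    gcongr
    exact le_coulombIntegral_trialState hB
  have hc' : ((1 / 2 * D : ℝ) : EReal) ≤
      ((ENNReal.ofReal (1 / 2) * coulombIntegral (trialState B) : ENNReal) : EReal) := by
    -- `D` can be negative (for instance at `B = e`), where `ENNReal.ofReal` truncates it to `0`;
    -- truncation only helps.
    refine le_trans ?_ (EReal.coe_ennreal_le_coe_ennreal_iff.2 hc)
    rw [EReal.coe_ennreal_ofReal]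
    exact EReal.coe_le_coe_iff.2 (le_max_left _ _)
  have hk : (kineticEnergy B (trialState B) : EReal) = ((B + Real.log B ^ 2 / 48 : ℝ) : EReal) := by
    rw [kineticEnergy_trialState hB, EReal.coe_ennreal_ofReal, max_eq_left (by positivity)]
  rw [pekarFunctional, hk]
  refine (EReal.sub_le_sub le_rfl hc').trans ?_
  rw [← EReal.coe_sub, EReal.coe_le_coe_iff]
  -- The leftover term is `(L / 12) (1 - log (2 / 3))`, at most `L / 6`, so the constant `1`
  -- suffices.
  have h23 : -1 ≤ Real.log (2 / 3) := by
    have := Real.one_sub_inv_le_log_of_pos (show (0 : ℝ) < 2 / 3 by norm_num)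
    norm_num at this ⊢
    linarith
  rw [hD]
  nlinarith

end

theorem corollary4 :
    ∃ C : ℝ, 0 < C ∧ ∀ B : ℝ, 1 < B →
      (MemH1A B (trialState B) ∧ eLpNorm (trialState B) 2 volume = 1) ∧
      pekarGroundEnergy 1 B ≤ pekarFunctional 1 B (trialState B) ∧
      pekarFunctional 1 B (trialState B) ≤
        ((B - 1 / 48 * Real.log B ^ 2
          + 1 / 12 * Real.log B * Real.log (Real.log B) + C * Real.log B : ℝ) : EReal) :=
  ⟨1, one_pos, fun _ hB => ⟨⟨memH1A_trialState hB, eLpNorm_trialState hB⟩,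
    sInf_le ⟨_, memH1A_trialState hB, eLpNorm_trialState hB, rfl⟩,
    pekarFunctional_trialState_le hB⟩⟩
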